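/- Let $d\in\mathbb N$, let $(\Omega,\mathcal F,\mathbb P)$ be a probability space and let $(\tau_x)_{x\in\mathbb R^d}$ be an action of $(\mathbb R^d,+)$ on $\Omega$ such that $(x,\omega)\mapsto\tau_x\omega$ is product measurable and every $\tau_x$ preserves $\mathbb P$ (ergodicity is not assumed). Let $V:\Omega\to[0,\infty)$ be a potential, that is, $V$ is measurable and $\mathbb P$-integrable and, for every $\omega\in\Omega$, the realisation $V_\omega(x):=V(\tau_x\omega)$, $x\in\mathbb R^d$, is not Lebesgue-almost everywhere equal to $0$. Let $Z=(Z_t)_{t\ge 0}$ be the canonical process on $C([0,\infty),\mathbb R^d)$, and let $E_x^\lambda$ denote the expectation under the law of $d$-dimensional Brownian motion with constant drift $\lambda\in\mathbb R^d$ started at $x\in\mathbb R^d$; write $E_x=E_x^0$ and $E^\lambda=E_0^\lambda$. The Green measure is $$G(x,A,\omega):=E_x\Big[\int_0^\infty \exp\Big\{-\int_0^tV_\omega(Z_s)\,ds\Big\}\mathbf 1_A(Z_t)\,dt\Big],\qquad A\subseteq\mathbb R^d \text{ Borel}.$$ Assume condition (G): for every $\omega\in\Omega$ the measure $G(0,\cdot,\omega)$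 has a continuous density $g(0,\cdot,\omega):\mathbb R^d\setminus\{0\}\to[0,\infty)$ with respect to Lebesgue measure (the Green function), this density is of class $C^2$ on $\mathbb R^d\setminus\{0\}$, and $$\tfrac12\Delta g(0,\cdot,\omega)-V_\omega\, g(0,\cdot,\omega)=0\qquad\text{on }\mathbb R^d\setminus\{0\}.$$ Define the quenched free energy $$\Lambda_\omega(\lambda):=\limsup_{t\to\infty}\frac1t\ln E^\lambda\Big[\exp\Big\{-\int_0^tV_\omega(Z_s)\,ds\Big\}\Big]\in[-\infty,0],\qquad \lambda\in\mathbb R^d,$$ and, for $a:\mathbb R^d\to[-\infty,\infty]$, $$\mathcal R(a)(y):=\sup\{\langle y,\lambda\rangle:\ \lambda\in\mathbb R^d,\ |\lambda|^2/2<a(\lambda)\},\qquad \sup\emptyset:=-\infty .$$ Then for every $\omega\in\Omega$ and every $y\in\mathbb R^d\setminus\{0\}$, $$\liminf_{r\to\infty}-\frac1r\ln g(0,ry,\omega)\ \ge\ \mathcal R(-\Lambda_\omega)(y).$$ Here $e^{-\infty}=0$, $\ln 0=-\infty$, and the inequality is understood in $[-\infty,\infty]$. -/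

import Mathlib

open MeasureTheory ProbabilityTheory Filter
open scoped NNReal ENNReal Laplacian

namespace GreenDecay

noncomputable section

/-- The path space `C([0,∞), ℝ^d)`. -/
abbrev PathSpace (d : ℕ) : Type := C(ℝ≥0, EuclideanSpace ℝ (Fin d))

/-- The cylindrical `σ`-field on the path space, generated by the evaluations `w ↦ w t`. -/
instance instMeasurableSpacePath (d : ℕ) : MeasurableSpace (PathSpace d) :=
  MeasurableSpace.comap (fun (w : PathSpace d) (t : ℝ≥0) => w t) MeasurableSpace.pi

theorem measurable_eval (d : ℕ) (t : ℝ≥0) : Measurable (fun w : PathSpace d => w t) :=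
  (measurable_pi_apply t).comp (comap_measurable _)

/-- `P` is the law on path space of standard `d`-dimensional Brownian motion started at `0`: the
coordinate processes are independent one-dimensional standard Brownian motions. -/
structure IsWienerMeasure {d : ℕ} (P : Measure (PathSpace d)) : Prop where
  isProbabilityMeasure : IsProbabilityMeasure P
  isBrownian : ∀ i : Fin d, IsBrownianReal (fun (t : ℝ≥0) (w : PathSpace d) => w t i) P
  indep : iIndepFun (fun (i : Fin d) (w : PathSpace d) (t : ℝ≥0) => w t i) P

/-- The path `t ↦ x + t λ + w t`. -/
def driftPath {d : ℕ} (x lam : EuclideanSpace ℝ (Fin d)) (w : PathSpace d) : PathSpace d where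
  toFun t := x + (t : ℝ) • lam + w t
  continuous_toFun := by fun_prop

theorem measurable_driftPath {d : ℕ} (x lam : EuclideanSpace ℝ (Fin d)) :
    Measurable (driftPath x lam) := by
  refine measurable_comap_iff.2 (measurable_pi_lambda _ fun t => ?_)
  exact (measurable_eval d t).const_add (x + (t : ℝ) • lam)

/-- The law `P_x^λ` of Brownian motion with drift `λ` started at `x`, obtained from the
Wiener measure `P = P_0^0`. -/
def driftLaw {d : ℕ} (P : Measure (PathSpace d)) (x lam : EuclideanSpace ℝ (Fin d)) :
    Measure (PathSpace d) :=
  P.map (driftPath x lam)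

/-- The functional `exp(-∫_0^t V_ω(Z_s) ds)` of a path, where `V_ω(x) = V(τ_x ω)` and
`τ_x ω = x +ᵥ ω`. The integral of the nonnegative realisation may be infinite, in which case
the value is `exp(-∞) = 0`. -/
def survival {d : ℕ} {Ω : Type*} [AddAction (EuclideanSpace ℝ (Fin d)) Ω] (V : Ω → ℝ) (ω : Ω)
    (t : ℝ) (w : PathSpace d) : ℝ≥0∞ :=
  EReal.exp (-((∫⁻ s in Set.Icc (0 : ℝ) t,
    ENNReal.ofReal (V (w s.toNNReal +ᵥ ω)) : ℝ≥0∞) : EReal))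

/-- The Green measure
`G(x, A, ω) = E_x [∫_0^∞ exp(-∫_0^t V_ω(Z_s) ds) 1_A(Z_t) dt]`. -/
def greenMeasure {d : ℕ} {Ω : Type*} [AddAction (EuclideanSpace ℝ (Fin d)) Ω]
    (P : Measure (PathSpace d)) (V : Ω → ℝ) (x : EuclideanSpace ℝ (Fin d))
    (A : Set (EuclideanSpace ℝ (Fin d))) (ω : Ω) : ℝ≥0∞ :=
  ∫⁻ w, (∫⁻ t in Set.Ici (0 : ℝ),
    survival V ω t w * A.indicator (fun _ => (1 : ℝ≥0∞)) (w t.toNNReal)) ∂(driftLaw P x 0)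

/-- `γ` is the Green function `g(x, ·, ω) : ℝ^d ∖ {x} → [0,∞)`, i.e. the continuous density of the
Green measure `G(x, ·, ω)` with respect to Lebesgue measure. These conditions determine `γ` away
from `x`; the value of `γ` at `x` is irrelevant. -/
structure IsGreenFunction {d : ℕ} {Ω : Type*} [AddAction (EuclideanSpace ℝ (Fin d)) Ω]
    (P : Measure (PathSpace d)) (V : Ω → ℝ) (x : EuclideanSpace ℝ (Fin d)) (ω : Ω)
    (γ : EuclideanSpace ℝ (Fin d) → ℝ) : Prop where
  nonneg : ∀ z, z ≠ x → 0 ≤ γ z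
  continuousOn : ContinuousOn γ {x}ᶜ
  density : ∀ A : Set (EuclideanSpace ℝ (Fin d)), MeasurableSet A →
    greenMeasure P V x A ω = ∫⁻ z in A, ENNReal.ofReal (γ z)

/-- A potential: a nonnegative integrable function on `Ω` no realisation of which vanishes
Lebesgue-almost everywhere. -/
structure IsPotential (d : ℕ) {Ω : Type*} [MeasurableSpace Ω]
    [AddAction (EuclideanSpace ℝ (Fin d)) Ω] (μ : Measure Ω) (V : Ω → ℝ) : Prop where
  measurable : Measurable V
  integrable : Integrable V μ
  nonneg : ∀ ω, 0 ≤ V ω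
  not_negligible : ∀ ω, ¬ ∀ᵐ x : EuclideanSpace ℝ (Fin d), V (x +ᵥ ω) = 0

/-- Condition (G) on the potential `V`, with `g ω = g(0, ·, ω)`: for every `ω`, the Green function
`g(0, ·, ω)` is `C²` on `ℝ^d ∖ {0}` and `(1/2) Δ g(0, ·, ω) - V_ω g(0, ·, ω) = 0` there. -/
structure ConditionG {d : ℕ} {Ω : Type*} [AddAction (EuclideanSpace ℝ (Fin d)) Ω]
    (P : Measure (PathSpace d)) (V : Ω → ℝ) (g : Ω → EuclideanSpace ℝ (Fin d) → ℝ) : Prop where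
  isGreenFunction : ∀ ω, IsGreenFunction P V 0 ω (g ω)
  contDiffOn : ∀ ω, ContDiffOn ℝ 2 (g ω) {0}ᶜ
  equation : ∀ ω, ∀ z, z ≠ 0 → (1 / 2 : ℝ) * Δ (g ω) z - V (z +ᵥ ω) * g ω z = 0

/-- The quenched free energy
`Λ_ω(λ) = limsup_{t → ∞} (1/t) ln E^λ [exp(-∫_0^t V_ω(Z_s) ds)]`, with `ln 0 = -∞`. -/
def quenchedFreeEnergy {d : ℕ} {Ω : Type*} [AddAction (EuclideanSpace ℝ (Fin d)) Ω]
    (P : Measure (PathSpace d)) (V : Ω → ℝ) (ω : Ω) (lam : EuclideanSpace ℝ (Fin d)) : EReal :=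
  limsup (fun t : ℝ => ((1 / t : ℝ) : EReal) *
    ENNReal.log (∫⁻ w, survival V ω t w ∂(driftLaw P 0 lam))) atTop

/-- `R(a)(y) = sup {⟨y, λ⟩ : λ ∈ ℝ^d, |λ|²/2 < a(λ)}` with `sup ∅ = -∞`. -/
def rateTransform {d : ℕ} (a : EuclideanSpace ℝ (Fin d) → EReal)
    (y : EuclideanSpace ℝ (Fin d)) : EReal :=
  ⨆ lam ∈ {lam : EuclideanSpace ℝ (Fin d) | ((‖lam‖ ^ 2 / 2 : ℝ) : EReal) < a lam},
    ((inner ℝ y lam : ℝ) : EReal)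

end

end GreenDecay

/-! Fix $\lambda$ with $|\lambda|^2/2<-\Lambda_\omega(\lambda)$. Cameron-Martin gives
$E[e^{-\int_0^tV}e^{\langle\lambda,Z_t\rangle}]=e^{|\lambda|^2t/2}E^\lambda[e^{-\int_0^tV}]$.
Integrated over $t$, the right side is a finite $J$, because the expectation decays faster than
$e^{-|\lambda|^2t/2}$. So $G(0,\cdot)$ has a finite exponential moment, and Chebyshev bounds its
mass on the unit ball around $x$ by $e^{|\lambda|-\langle\lambda,x\rangle}J$
(`greenMeasure_ball_le`, `lintegral_exp_mul_survival_lt_top`).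

Passing from balls to points uses condition (G): $\Delta g=2Vg\ge0$ away from $0$, so $g$ is
subharmonic there and $g(x)$ is at most a constant, independent of $x$, times its integral over the
ball (`exists_le_setLIntegral_of_laplacian_nonneg`). Hence $g(ry)\le
CJe^{|\lambda|}e^{-r\langle\lambda,y\rangle}$ for large $r$; take logarithms, then the supremum over
$\lambda$.

Cameron-Martin on path space (`IsWienerMeasure.lintegral_driftLaw`) reduces to a Gaussian shift in
$\mathbb R^d$: up to time $t$ a drift moves the end point and leaves the bridge, which is
independent of it, unchanged. -/

namespace GreenDecay

/-! ### Gaussian shifts in finite dimension -/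

/-- The density of a Gaussian law shifted in the direction `c` with respect to the centred one. -/
theorem gaussianReal_shift_eq_withDensity (c : ℝ) {v : ℝ≥0} (hv : v ≠ 0) :
    gaussianReal (v * c) v =
      (gaussianReal 0 v).withDensity (fun x => ENNReal.ofReal (Real.exp (c * x - c ^ 2 * v / 2))) := by
  rw [gaussianReal_of_var_ne_zero _ hv, gaussianReal_of_var_ne_zero _ hv,
    ← withDensity_mul _ (measurable_gaussianPDF _ _) (by fun_prop)]
  congr 1
  ext x
  have hv' : (v : ℝ) ≠ 0 := by exact_mod_cast hv
  rw [Pi.mul_apply, gaussianPDF_def, gaussianPDF_def, ← ENNReal.ofReal_mul (gaussianPDFReal_nonneg _ _ _)]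
  simp only [gaussianPDFReal_def]
  rw [mul_assoc (b := Real.exp _), ← Real.exp_add]
  congr 3
  field_simp
  ring

/-- A product of measures with densities has the product density. -/
theorem pi_withDensity {ι : Type*} [Fintype ι] {X : ι → Type*} [∀ i, MeasurableSpace (X i)]
    (μ : ∀ i, Measure (X i)) [∀ i, IsProbabilityMeasure (μ i)] {f : ∀ i, X i → ℝ≥0∞}
    (hf : ∀ i, Measurable (f i)) [∀ i, SigmaFinite ((μ i).withDensity (f i))] :
    Measure.pi (fun i => (μ i).withDensity (f i)) =
      (Measure.pi μ).withDensity (fun x => ∏ i, f i (x i)) := by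
  refine Measure.pi_eq fun s hs => ?_
  rw [withDensity_apply _ (MeasurableSet.univ_pi hs),
    ← lintegral_indicator (MeasurableSet.univ_pi hs)]
  have key : ∀ x, (Set.univ.pi s).indicator (fun x => ∏ i, f i (x i)) x =
      ∏ i, (s i).indicator (f i) (x i) := by
    intro x
    by_cases hx : x ∈ Set.univ.pi s
    · rw [Set.indicator_of_mem hx]
      exact Finset.prod_congr rfl fun i _ => (Set.indicator_of_mem (hx i trivial) _).symm
    · rw [Set.indicator_of_notMem hx]
      simp only [Set.mem_pi, Set.mem_univ, true_implies, not_forall] at hx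
      obtain ⟨i, hi⟩ := hx
      exact (Finset.prod_eq_zero (Finset.mem_univ i) (Set.indicator_of_notMem hi _)).symm
  simp_rw [key]
  have hind := iIndepFun_pi (μ := μ) (X := fun i => (s i).indicator (f i))
    fun i => ((hf i).indicator (hs i)).aemeasurable
  have h := lintegral_prod_eq_prod_lintegral_of_indepFun Finset.univ _ hind fun i =>
    ((hf i).indicator (hs i)).comp (measurable_pi_apply i)
  rw [h]
  refine Finset.prod_congr rfl fun i _ => ?_
  rw [withDensity_apply _ (hs i), ← lintegral_indicator (hs i)]
  exact (measurePreserving_eval μ i).lintegral_comp ((hf i).indicator (hs i))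

/-- The Cameron-Martin formula for a product of identical centred Gaussian laws. -/
theorem lintegral_pi_gaussianReal_shift {ι : Type*} [Fintype ι] (c : ι → ℝ) {v : ℝ≥0} (hv : v ≠ 0)
    {h : (ι → ℝ) → ℝ≥0∞} (hh : Measurable h) :
    ∫⁻ x, h (fun i => x i + v * c i) ∂(Measure.pi fun _ : ι => gaussianReal 0 v) =
      ∫⁻ x, h x * ENNReal.ofReal (Real.exp (∑ i, (c i * x i - c i ^ 2 * v / 2)))
        ∂(Measure.pi fun _ : ι => gaussianReal 0 v) := by
  have hm : Measurable (fun (x : ι → ℝ) i => x i + v * c i) := by fun_prop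
  rw [← lintegral_map hh hm,
    Measure.pi_map_pi (μ := fun _ : ι => gaussianReal 0 v) (f := fun i y => y + v * c i)
      fun i => by fun_prop]
  have h1 : ∀ i, (gaussianReal 0 v).map (fun y => y + v * c i) = (gaussianReal 0 v).withDensity
      (fun x => ENNReal.ofReal (Real.exp (c i * x - c i ^ 2 * v / 2))) := fun i => by
    rw [gaussianReal_map_add_const, zero_add, gaussianReal_shift_eq_withDensity _ hv]
  have : ∀ i, SigmaFinite ((gaussianReal 0 v).withDensity
      (fun x => ENNReal.ofReal (Real.exp (c i * x - c i ^ 2 * v / 2)))) := fun i => by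
    rw [← gaussianReal_shift_eq_withDensity _ hv]; infer_instance
  simp_rw [h1]
  rw [pi_withDensity _ fun i => by fun_prop,
    lintegral_withDensity_eq_lintegral_mul _ (by fun_prop) hh]
  refine lintegral_congr fun x => ?_
  rw [Pi.mul_apply, mul_comm, Real.exp_sum, ENNReal.ofReal_prod_of_nonneg fun i _ => (Real.exp_pos _).le]

/-! ### Bridge decomposition and Cameron-Martin on path space -/

/-- The coordinates of a Wiener process form a Gaussian process. -/
theorem IsWienerMeasure.isGaussianProcess {d : ℕ} {P : Measure (PathSpace d)}
    (hP : IsWienerMeasure P) :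
    IsGaussianProcess (fun (p : Fin d × ℝ≥0) (w : PathSpace d) => w p.2 p.1) P where
  hasGaussianLaw I := by
    classical
    -- Enlarging the index set to a product `Fin d × J` lets independence of the coordinates apply;
    -- `L` then selects the indices in `I`.
    let J : Finset ℝ≥0 := I.image Prod.snd
    have hJ : HasGaussianLaw (fun (w : PathSpace d) (i : Fin d) (s : J) => w s i) P := by
      refine iIndepFun.hasGaussianLaw (fun i =>
        (IsPreBrownianReal.isGaussianProcess (hP.isBrownian i).1).hasGaussianLaw J) ?_
      exact hP.indep.comp (fun _ f (s : J) => f s) fun i => by fun_prop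
    let L : (Fin d → J → ℝ) →L[ℝ] (I → ℝ) :=
      { toFun x p := x p.1.1 ⟨p.1.2, Finset.mem_image_of_mem _ p.2⟩
        map_add' x y := by ext; simp
        map_smul' c x := by ext; simp }
    exact hJ.map L

theorem IsWienerMeasure.covariance_eval {d : ℕ} {P : Measure (PathSpace d)}
    (hP : IsWienerMeasure P) (i j : Fin d) (s t : ℝ≥0) :
    cov[fun w : PathSpace d => w s i, fun w => w t j; P] = if i = j then (min s t : ℝ) else 0 := by
  split_ifs with hij
  · subst hij
    simpa using (hP.isBrownian i).covariance_fun_eval s t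
  · refine IndepFun.covariance_eq_zero ?_ (hP.isGaussianProcess.hasGaussianLaw_eval (i, s)).memLp_two
      (hP.isGaussianProcess.hasGaussianLaw_eval (j, t)).memLp_two
    exact (hP.indep.indepFun hij).comp (measurable_pi_apply s) (measurable_pi_apply t)

noncomputable section

/-- The bridge `s ↦ w (s ∧ t) - ((s ∧ t) / t) w t` of the path `w`. -/
def bridge {d : ℕ} (t : ℝ≥0) (w : PathSpace d) : PathSpace d where
  toFun s := w (min s t) - ((min s t : ℝ≥0) / t : ℝ) • w t
  continuous_toFun := by fun_prop

/-- The path `s ↦ b s + ((s ∧ t) / t) x`. -/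
def addRamp {d : ℕ} (t : ℝ≥0) (b : PathSpace d) (x : EuclideanSpace ℝ (Fin d)) : PathSpace d where
  toFun s := b s + ((min s t : ℝ≥0) / t : ℝ) • x
  continuous_toFun := by fun_prop

end

theorem measurable_bridge {d : ℕ} (t : ℝ≥0) : Measurable (bridge (d := d) t) := by
  refine measurable_comap_iff.2 (measurable_pi_lambda _ fun s => ?_)
  exact (measurable_eval d _).sub ((measurable_eval d t).const_smul ((min s t : ℝ≥0) / t : ℝ))

theorem measurable_addRamp {d : ℕ} (t : ℝ≥0) :
    Measurable (fun p : PathSpace d × EuclideanSpace ℝ (Fin d) => addRamp t p.1 p.2) := by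
  refine measurable_comap_iff.2 (measurable_pi_lambda _ fun s => ?_)
  exact ((measurable_eval d s).comp measurable_fst).add (measurable_snd.const_smul ((min s t : ℝ≥0) / t : ℝ))

/-- The bridge of a Wiener process is independent of its end point. -/
theorem IsWienerMeasure.indepFun_bridge {d : ℕ} {P : Measure (PathSpace d)}
    (hP : IsWienerMeasure P) {t : ℝ≥0} (ht : t ≠ 0) :
    IndepFun (bridge t) (fun (w : PathSpace d) (i : Fin d) => w t i) P := by
  classical
  have := hP.isProbabilityMeasure
  have hG := hP.isGaussianProcess
  have hmem : ∀ (s : ℝ≥0) (i : Fin d), MemLp (fun w : PathSpace d => w s i) 2 P := fun s i =>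
    (hG.hasGaussianLaw_eval (i, s)).memLp_two
  have hev : ∀ (s : ℝ≥0) (i : Fin d), Measurable (fun w : PathSpace d => w s i) := fun s i =>
    (show Measurable fun x : EuclideanSpace ℝ (Fin d) => x i by fun_prop).comp (measurable_eval d s)
  let X : Fin d × ℝ≥0 → PathSpace d → ℝ := fun p w =>
    w (min p.2 t) p.1 - ((min p.2 t : ℝ≥0) / t : ℝ) * w t p.1
  have hXY : IsGaussianProcess (Sum.elim X (fun (i : Fin d) (w : PathSpace d) => w t i)) P := by
    refine hG.of_isGaussianProcess fun s => ?_
    rcases s with p | i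
    · refine ⟨{(p.1, min p.2 t), (p.1, t)},
        { toFun x := x ⟨(p.1, min p.2 t), by simp⟩ -
            ((min p.2 t : ℝ≥0) / t : ℝ) * x ⟨(p.1, t), by simp⟩
          map_add' x y := by simp; ring
          map_smul' c x := by simp; ring }, fun w => rfl⟩
    · exact ⟨{(i, t)},
        { toFun x := x ⟨(i, t), by simp⟩
          map_add' x y := by simp
          map_smul' c x := by simp }, fun w => rfl⟩
  -- For jointly Gaussian families it suffices that covariances vanish. Those with equal coordinates
  -- are $(s\wedge t)-\frac{s\wedge t}{t}\,t=0$.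
  have hind := hXY.indepFun_of_covariance_eq_zero
    (fun p => (Measurable.sub (hev (min p.2 t) p.1)
      ((hev t p.1).const_mul ((min p.2 t : ℝ≥0) / t : ℝ))).aemeasurable)
    (fun i => (hev _ _).aemeasurable) fun p j => by
      have h1 : X p = (fun w : PathSpace d => w (min p.2 t) p.1) -
        fun w : PathSpace d => ((min p.2 t : ℝ≥0) / t : ℝ) * w t p.1 := rfl
      rw [h1, covariance_sub_left (hmem _ _) ((hmem _ _).const_mul _) (hmem _ _),
        covariance_const_mul_left, hP.covariance_eval, hP.covariance_eval]
      split_ifs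
      · have : (t : ℝ) ≠ 0 := by exact_mod_cast ht
        simp [this]
      · simp
  have hc := hind.comp (φ := fun (f : Fin d × ℝ≥0 → ℝ) (s : ℝ≥0) =>
      WithLp.toLp 2 fun i : Fin d => f (i, s)) (ψ := id) (by fun_prop) measurable_id
  rw [IndepFun_iff_Indep] at hc ⊢
  have hcomap : (instMeasurableSpacePath d).comap (bridge t) =
      MeasurableSpace.pi.comap ((fun (w : PathSpace d) (s : ℝ≥0) => w s) ∘ bridge t) :=
    MeasurableSpace.comap_comp
  rw [hcomap]
  exact hc

/-- The Cameron-Martin formula for functionals of the Wiener process up to time `t`. -/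
theorem IsWienerMeasure.lintegral_driftLaw {d : ℕ} {P : Measure (PathSpace d)}
    (hP : IsWienerMeasure P) (lam : EuclideanSpace ℝ (Fin d)) {t : ℝ≥0} (ht : t ≠ 0)
    {F : PathSpace d → ℝ≥0∞} (hF : Measurable F)
    (hloc : ∀ w w' : PathSpace d, (∀ s ≤ t, w s = w' s) → F w = F w') :
    ∫⁻ w, F w ∂(driftLaw P 0 lam) =
      ∫⁻ w, F w * ENNReal.ofReal (Real.exp (inner ℝ lam (w t) - ‖lam‖ ^ 2 * t / 2)) ∂P := by
  have := hP.isProbabilityMeasure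
  have ht' : (t : ℝ) ≠ 0 := by exact_mod_cast ht
  have hmY : Measurable (fun (w : PathSpace d) (i : Fin d) => w t i) :=
    (show Measurable fun (x : EuclideanSpace ℝ (Fin d)) (i : Fin d) => x i by fun_prop).comp
      (measurable_eval d t)
  have hlawY : P.map (fun (w : PathSpace d) (i : Fin d) => w t i) =
      Measure.pi fun _ : Fin d => gaussianReal 0 t := by
    rw [(iIndepFun_iff_map_fun_eq_pi_map fun i => (measurable_pi_iff.1 hmY i).aemeasurable).1
      (hP.indep.comp (fun _ f => f t) fun i => measurable_pi_apply t)]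
    congr 1
    ext1 i
    exact ((hP.isBrownian i).hasLaw_eval t).map_eq
  have hlaw := (indepFun_iff_map_prod_eq_prod_map_map (measurable_bridge t).aemeasurable
    hmY.aemeasurable).1 (hP.indepFun_bridge ht)
  rw [hlawY] at hlaw
  have hmp := (measurable_bridge t).prodMk hmY
  have htoLp : Measurable (fun x : Fin d → ℝ => WithLp.toLp 2 x) := by fun_prop
  -- `F` as a function of bridge and end point: on $[0,t]$ the ramp restores the path, and a drift
  -- only adds $t\lambda$ to the end point. Agreement on $[0,t]$ suffices by `hloc`.
  let H : PathSpace d × (Fin d → ℝ) → ℝ≥0∞ := fun p => F (addRamp t p.1 (WithLp.toLp 2 p.2))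
  have hH : Measurable H := hF.comp ((measurable_addRamp t).comp
    (measurable_fst.prodMk (htoLp.comp measurable_snd)))
  let D : (Fin d → ℝ) → ℝ≥0∞ := fun x =>
    ENNReal.ofReal (Real.exp (∑ i, (lam i * x i - lam i ^ 2 * t / 2)))
  have hD : Measurable D := by fun_prop
  have hshift : Measurable fun x : Fin d → ℝ => fun i => x i + t * lam i := by fun_prop
  have hleft : ∀ w : PathSpace d, F (driftPath 0 lam w) =
      H (bridge t w, fun i => w t i + t * lam i) := fun w => by
    refine hloc _ _ fun s hs => ?_
    ext i
    simp only [driftPath, addRamp, bridge, ContinuousMap.coe_mk, min_eq_left hs, PiLp.add_apply,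
      PiLp.sub_apply, PiLp.smul_apply, smul_eq_mul, PiLp.zero_apply]
    field_simp
    ring
  have hright : ∀ w : PathSpace d,
      F w * ENNReal.ofReal (Real.exp (inner ℝ lam (w t) - ‖lam‖ ^ 2 * t / 2)) =
        H (bridge t w, fun i => w t i) * D fun i => w t i := fun w => by
    congr 1
    · refine hloc _ _ fun s hs => ?_
      ext i
      simp only [addRamp, bridge, ContinuousMap.coe_mk, min_eq_left hs, PiLp.add_apply,
        PiLp.sub_apply, PiLp.smul_apply, smul_eq_mul]
      ring
    · simp only [D]
      congr 2
      rw [Finset.sum_sub_distrib, ← Finset.sum_div, ← Finset.sum_mul, EuclideanSpace.real_norm_sq_eq]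
      simp [PiLp.inner_apply, mul_comm]
  rw [driftLaw, lintegral_map hF (measurable_driftPath 0 lam), lintegral_congr hleft,
    lintegral_congr hright]
  have hH1 : Measurable fun p : PathSpace d × (Fin d → ℝ) => H (p.1, fun i => p.2 i + t * lam i) :=
    hH.comp (measurable_fst.prodMk (hshift.comp measurable_snd))
  have hH2 : Measurable fun p : PathSpace d × (Fin d → ℝ) => H p * D p.2 :=
    hH.mul (hD.comp measurable_snd)
  rw [← lintegral_map hH1 hmp, ← lintegral_map hH2 hmp, hlaw, lintegral_prod _ hH1.aemeasurable,
    lintegral_prod _ hH2.aemeasurable]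
  refine lintegral_congr fun b => ?_
  exact lintegral_pi_gaussianReal_shift (fun i => lam i) ht
    (hH.comp (measurable_const.prodMk measurable_id))

/-! ### Sub-mean-value inequality for subharmonic functions -/

section SubMeanValue

variable {E : Type*} [NormedAddCommGroup E]

/-- A smooth radial bump function supported in the unit ball. -/
noncomputable def radialBump (z : E) : ℝ := expNegInvGlue (1 - ‖z‖ ^ 2)

/-- The radial weight `η ≥ 0` with `∇ radialBump z = -η z • z`. -/
noncomputable def radialWeight (z : E) : ℝ := 2 * deriv expNegInvGlue (1 - ‖z‖ ^ 2)

/-- Such points are global minima of a nonnegative function. -/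
theorem deriv_expNegInvGlue_of_nonpos {t : ℝ} (ht : t ≤ 0) : deriv expNegInvGlue t = 0 := by
  refine IsLocalMin.deriv_eq_zero (Eventually.of_forall fun s => ?_)
  rw [expNegInvGlue.zero_of_nonpos ht]
  exact expNegInvGlue.nonneg s

theorem radialBump_nonneg (z : E) : 0 ≤ radialBump z := expNegInvGlue.nonneg _

theorem radialWeight_nonneg (z : E) : 0 ≤ radialWeight z :=
  mul_nonneg zero_le_two expNegInvGlue.monotone.deriv_nonneg

theorem one_sub_norm_sq_nonpos {z : E} (hz : z ∉ Metric.ball (0 : E) 1) : 1 - ‖z‖ ^ 2 ≤ 0 := by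
  have : 1 ≤ ‖z‖ := by simpa using hz
  nlinarith

theorem radialBump_eq_zero {z : E} (hz : z ∉ Metric.ball (0 : E) 1) : radialBump z = 0 :=
  expNegInvGlue.zero_of_nonpos (one_sub_norm_sq_nonpos hz)

theorem radialWeight_eq_zero {z : E} (hz : z ∉ Metric.ball (0 : E) 1) : radialWeight z = 0 := by
  rw [radialWeight, deriv_expNegInvGlue_of_nonpos (one_sub_norm_sq_nonpos hz), mul_zero]

theorem continuous_radialBump : Continuous (radialBump (E := E)) :=
  (expNegInvGlue.contDiff (n := 0)).continuous.comp (continuous_const.sub (continuous_norm.pow 2))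

theorem continuous_radialWeight : Continuous (radialWeight (E := E)) :=
  (((expNegInvGlue.contDiff (n := 1)).continuous_deriv (by norm_num)).comp
    (g := fun t => deriv expNegInvGlue t) (f := fun z : E => 1 - ‖z‖ ^ 2)
    (continuous_const.sub (continuous_norm.pow 2))).const_mul 2

variable [InnerProductSpace ℝ E]

theorem hasFDerivAt_radialBump (z : E) :
    HasFDerivAt (radialBump (E := E)) (-(radialWeight z) • innerSL ℝ z) z := by
  have h1 : HasDerivAt expNegInvGlue (deriv expNegInvGlue (1 - ‖z‖ ^ 2)) (1 - ‖z‖ ^ 2) :=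
    ((expNegInvGlue.contDiff (n := 1)).differentiable (by norm_num) _).hasDerivAt
  have h2 : HasFDerivAt (fun z : E => 1 - ‖z‖ ^ 2) (-(2 • innerSL ℝ z)) z :=
    (hasStrictFDerivAt_norm_sq z).hasFDerivAt.const_sub 1
  refine (h1.comp_hasFDerivAt z h2).congr_fderiv ?_
  ext v
  simp [radialWeight]
  ring

variable [FiniteDimensional ℝ E]

theorem hasCompactSupport_radialBump : HasCompactSupport (radialBump (E := E)) :=
  HasCompactSupport.intro (isCompact_closedBall (0 : E) 1) fun _ hz =>
    radialBump_eq_zero fun h => hz (Metric.ball_subset_closedBall h)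

theorem hasCompactSupport_radialWeight : HasCompactSupport (radialWeight (E := E)) :=
  HasCompactSupport.intro (isCompact_closedBall (0 : E) 1) fun _ hz =>
    radialWeight_eq_zero fun h => hz (Metric.ball_subset_closedBall h)

variable [MeasurableSpace E] [BorelSpace E]

/-- The mean value theorem on $[0,1]$ yields $c$ where `expNegInvGlue` has positive slope; the
weight is positive at any point of norm $\sqrt{1-c}$. -/
theorem integral_radialWeight_pos [Nontrivial E] : 0 < ∫ z : E, radialWeight z := by
  obtain ⟨c, hc, hc'⟩ := exists_deriv_eq_slope expNegInvGlue (zero_lt_one' ℝ)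
    (expNegInvGlue.contDiff (n := 0)).continuous.continuousOn
    ((expNegInvGlue.contDiff (n := 1)).differentiable (by norm_num)).differentiableOn
  obtain ⟨z, hz⟩ := exists_norm_eq E (Real.sqrt_nonneg (1 - c))
  refine continuous_radialWeight.integral_pos_of_hasCompactSupport_nonneg_nonzero
    hasCompactSupport_radialWeight radialWeight_nonneg (x := z) ?_
  rw [radialWeight, hz, Real.sq_sqrt (by linarith [hc.2]), sub_sub_cancel, hc']
  have := expNegInvGlue.pos_of_pos (zero_lt_one' ℝ)
  simp [expNegInvGlue.zero, this.ne']

/-- Integration by parts against the radial weight produces the Laplacian. -/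
theorem integral_fderiv_mul_radialWeight {f : E → ℝ} (hf : ContDiff ℝ 2 f) (x : E) (s : ℝ) :
    ∫ z, fderiv ℝ f (x + s • z) z * radialWeight z =
      s * ∫ z, Δ f (x + s • z) * radialBump z := by
  let b := stdOrthonormalBasis ℝ E
  have hf1 : ContDiff ℝ 1 (fderiv ℝ f) := hf.fderiv_right (by norm_num)
  have haff : ContDiff ℝ 1 (fun z : E => x + s • z) := by fun_prop
  let F : Fin (Module.finrank ℝ E) → E → ℝ := fun i z => fderiv ℝ f (x + s • z) (b i)
  have hF : ∀ i, ContDiff ℝ 1 (F i) := fun i => (hf1.comp haff).clm_apply contDiff_const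
  have hFd : ∀ i z, fderiv ℝ (F i) z (b i) = s * iteratedFDeriv ℝ 2 f (x + s • z) ![b i, b i] := by
    intro i z
    have h1 : HasFDerivAt (fun z : E => x + s • z) (s • ContinuousLinearMap.id ℝ E) z :=
      ((hasFDerivAt_id z).const_smul s).const_add x
    have h2 := (hf1.differentiable one_ne_zero (x + s • z)).hasFDerivAt.comp z h1
    have h3 := h2.clm_apply (hasFDerivAt_const (b i) z)
    have h4 : fderiv ℝ (F i) z = _ := h3.fderiv
    rw [h4, iteratedFDeriv_two_apply]
    simp
  have hcs : ∀ {G : E → ℝ}, HasCompactSupport fun z => G z * radialBump z := fun {G} =>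
    hasCompactSupport_radialBump.mul_left
  have hbumpd : ∀ z (v : E), fderiv ℝ (radialBump (E := E)) z v = -(radialWeight z) * inner ℝ z v :=
    fun z v => by rw [(hasFDerivAt_radialBump z).fderiv]; simp
  have hint : ∀ i, Integrable fun z => F i z * fderiv ℝ (radialBump (E := E)) z (b i) := fun i => by
    simp_rw [hbumpd]
    refine Continuous.integrable_of_hasCompactSupport ?_ ?_
    · exact (hF i).continuous.mul (continuous_radialWeight.neg.mul (by fun_prop))
    · exact (hasCompactSupport_radialWeight.neg.mul_right).mul_left
  have hint' : ∀ i, Integrable fun z => fderiv ℝ (F i) z (b i) * radialBump z := fun i =>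
    Continuous.integrable_of_hasCompactSupport
      ((((hF i).continuous_fderiv one_ne_zero).clm_apply continuous_const).mul
        continuous_radialBump) hcs
  have hparts : ∀ i, ∫ z, F i z * fderiv ℝ (radialBump (E := E)) z (b i) =
      -∫ z, fderiv ℝ (F i) z (b i) * radialBump z := fun i =>
    integral_mul_fderiv_eq_neg_fderiv_mul_of_integrable (hint' i) (hint i)
      (Continuous.integrable_of_hasCompactSupport
        ((hF i).continuous.mul continuous_radialBump) hcs)
      (fun z _ => (hF i).differentiable one_ne_zero z)
      (fun z _ => (hasFDerivAt_radialBump z).differentiableAt)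
  -- Expanding `z` in the orthonormal basis turns the radial derivative times the weight into
  -- $-\nabla f\cdot\nabla$`radialBump`, ready for integration by parts.
  have hL : ∀ z, fderiv ℝ f (x + s • z) z * radialWeight z =
      -∑ i, F i z * fderiv ℝ (radialBump (E := E)) z (b i) := fun z => by
    conv_lhs => rw [← b.sum_repr' z]
    simp only [map_sum, map_smul, smul_eq_mul, hbumpd, Finset.sum_mul, ← Finset.sum_neg_distrib, F]
    rw [b.sum_repr' z]
    refine Finset.sum_congr rfl fun i _ => ?_
    rw [real_inner_comm]
    ring
  have hR : ∀ z, s * (Δ f (x + s • z) * radialBump z) =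
      ∑ i, fderiv ℝ (F i) z (b i) * radialBump z := fun z => by
    rw [InnerProductSpace.laplacian_eq_iteratedFDeriv_orthonormalBasis f b]
    simp only [hFd, Finset.sum_mul, Finset.mul_sum]
    exact Finset.sum_congr rfl fun i _ => by ring
  rw [← integral_const_mul]
  simp_rw [hL, hR]
  rw [integral_neg, integral_finsetSum _ fun i _ => hint i,
    integral_finsetSum _ fun i _ => hint' i, ← Finset.sum_neg_distrib]
  exact Finset.sum_congr rfl fun i _ => by rw [hparts, neg_neg]

/-- The sub-mean-value property with respect to the radial weight. -/
theorem mul_integral_radialWeight_le {f : E → ℝ} (hf : ContDiff ℝ 2 f) (x : E)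
    (hΔ : ∀ z ∈ Metric.ball x 1, 0 ≤ Δ f z) :
    f x * ∫ z : E, radialWeight z ≤ ∫ z, f (x + z) * radialWeight z := by
  -- Write $f(x+z)-f(x)=\int_0^1 Df(x+sz)z\,ds$, integrate against the weight and swap. The inner
  -- integral is $s\int\Delta f(x+sz)\,$`radialBump`$(z)\,dz\ge0$.
  have hfd : Continuous (fderiv ℝ f) := hf.continuous_fderiv two_ne_zero
  have hcont : Continuous (Function.uncurry fun (s : ℝ) (z : E) =>
      fderiv ℝ f (x + s • z) z * radialWeight z) := by
    refine Continuous.mul ?_ (continuous_radialWeight.comp continuous_snd)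
    exact (hfd.comp (by fun_prop)).clm_apply continuous_snd
  have hint : Integrable (Function.uncurry fun (s : ℝ) (z : E) =>
      fderiv ℝ f (x + s • z) z * radialWeight z)
      ((volume.restrict (Set.uIoc (0 : ℝ) 1)).prod volume) := by
    have h1 : IntegrableOn (Function.uncurry fun (s : ℝ) (z : E) =>
        fderiv ℝ f (x + s • z) z * radialWeight z)
        (Set.Icc (0 : ℝ) 1 ×ˢ Metric.closedBall (0 : E) 1) (volume.prod volume) :=
      hcont.continuousOn.integrableOn_compact
        (isCompact_Icc.prod (isCompact_closedBall (0 : E) 1))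
    have h2 : IntegrableOn (Function.uncurry fun (s : ℝ) (z : E) =>
        fderiv ℝ f (x + s • z) z * radialWeight z)
        (Set.Icc (0 : ℝ) 1 ×ˢ Set.univ) (volume.prod volume) := by
      refine h1.of_forall_sdiff_eq_zero (measurableSet_Icc.prod MeasurableSet.univ) ?_
      rintro ⟨s, z⟩ ⟨⟨hs, -⟩, hz⟩
      have : z ∉ Metric.ball (0 : E) 1 := fun h => hz ⟨hs, Metric.ball_subset_closedBall h⟩
      simp [radialWeight_eq_zero this]
    rw [← Measure.restrict_univ (μ := (volume : Measure E)), Measure.prod_restrict]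
    refine h2.mono_set (Set.prod_mono ?_ subset_rfl)
    rw [Set.uIoc_of_le zero_le_one]
    exact Set.Ioc_subset_Icc_self
  have hftc : ∀ z, ∫ s in (0 : ℝ)..1, fderiv ℝ f (x + s • z) z * radialWeight z =
      f (x + z) * radialWeight z - f x * radialWeight z := fun z => by
    have h := intervalIntegral.integral_eq_sub_of_hasDerivAt (a := 0) (b := 1)
      (f := fun s : ℝ => f (x + s • z) * radialWeight z)
      (f' := fun s : ℝ => fderiv ℝ f (x + s • z) z * radialWeight z) (fun s _ => by
        have h1 : HasDerivAt (fun s : ℝ => x + s • z) z s := by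
          simpa using ((hasDerivAt_id s).smul_const z).const_add x
        exact ((hf.differentiable two_ne_zero (x + s • z)).hasFDerivAt.comp_hasDerivAt s
          h1).mul_const _)
        (Continuous.intervalIntegrable (hcont.comp (by fun_prop : Continuous fun s : ℝ => (s, z))) _ _)
    simpa using h
  have hswap := intervalIntegral_integral_swap hint
  simp_rw [hftc] at hswap
  have hi1 : Integrable fun z => f (x + z) * radialWeight z :=
    Continuous.integrable_of_hasCompactSupport
      ((hf.continuous.comp (by fun_prop)).mul continuous_radialWeight)
      hasCompactSupport_radialWeight.mul_left
  have hi2 : Integrable fun z : E => f x * radialWeight z :=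
    (continuous_radialWeight.integrable_of_hasCompactSupport
      hasCompactSupport_radialWeight).const_mul _
  rw [integral_sub hi1 hi2, integral_const_mul] at hswap
  rw [← sub_nonneg, ← hswap]
  refine intervalIntegral.integral_nonneg zero_le_one fun s hs => ?_
  rw [integral_fderiv_mul_radialWeight hf]
  refine mul_nonneg hs.1 (integral_nonneg fun z => ?_)
  by_cases hz : z ∈ Metric.ball (0 : E) 1
  · refine mul_nonneg (hΔ _ ?_) (radialBump_nonneg z)
    have hz' : ‖z‖ < 1 := by simpa using hz
    rw [mem_ball_iff_norm, add_sub_cancel_left, norm_smul, Real.norm_of_nonneg hs.1]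
    nlinarith [hs.1, hs.2, norm_nonneg z]
  · simp [radialBump_eq_zero hz]

/-- A nonnegative subharmonic function is controlled by its integral over the unit ball. -/
theorem exists_le_setLIntegral_of_laplacian_nonneg [Nontrivial E] :
    ∃ C : ℝ≥0, ∀ (f : E → ℝ) (x : E) (U : Set E), IsOpen U → Metric.closedBall x 2 ⊆ U →
      ContDiffOn ℝ 2 f U → (∀ z ∈ Metric.ball x 1, 0 ≤ f z) → (∀ z ∈ Metric.ball x 1, 0 ≤ Δ f z) →
      ENNReal.ofReal (f x) ≤ C * ∫⁻ z in Metric.ball x 1, ENNReal.ofReal (f z) := by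
  have hK := integral_radialWeight_pos (E := E)
  set K := ∫ z : E, radialWeight z
  obtain ⟨M, hM⟩ := hasCompactSupport_radialWeight.exists_bound_of_continuous
    (continuous_radialWeight (E := E))
  have hM0 : 0 ≤ M := (norm_nonneg _).trans (hM 0)
  -- `M` bounds the weight and `K` is its total mass; neither depends on `f` or `x`.
  refine ⟨(M / K).toNNReal, fun f x U hU hxU hf hf0 hΔ => ?_⟩
  -- The cutoff makes `f` globally $C^2$ without changing it on the unit ball; its support, of
  -- radius 2, lies in `U`.
  let χ : ContDiffBump x := ⟨1, 2, one_pos, one_lt_two⟩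
  have hχ : ∀ z ∈ Metric.ball x 1, (fun z => χ z * f z) =ᶠ[nhds z] f := fun z hz => by
    filter_upwards [Metric.isOpen_ball.mem_nhds hz] with w hw
    rw [χ.one_of_mem_closedBall (Metric.ball_subset_closedBall hw), one_mul]
  have hχf : ∀ z ∈ Metric.ball x 1, χ z * f z = f z := fun z hz => (hχ z hz).self_of_nhds
  have hsmooth : ContDiff ℝ 2 fun z => χ z * f z := contDiff_iff_contDiffAt.2 fun z => by
    by_cases hz : z ∈ Metric.closedBall x 2
    · exact (χ.contDiff (n := 2)).contDiffAt.mul (hf.contDiffAt (hU.mem_nhds (hxU hz)))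
    · refine (contDiffAt_const (c := 0)).congr_of_eventuallyEq ?_
      filter_upwards [Metric.isClosed_closedBall.isOpen_compl.mem_nhds hz] with w hw
      have hw' : (2 : ℝ) ≤ dist w x := by
        have : 2 < dist w x := by simpa using hw
        exact this.le
      rw [χ.zero_of_le_dist hw', zero_mul]
  have hsub := mul_integral_radialWeight_le hsmooth x fun z hz => by
    rw [(InnerProductSpace.laplacian_congr_nhds (hχ z hz)).self_of_nhds]
    exact hΔ z hz
  rw [hχf x (Metric.mem_ball_self one_pos)] at hsub
  have hmem : ∀ z, z ∈ Metric.ball (0 : E) 1 → x + z ∈ Metric.ball x 1 := fun z hz => by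
    simpa [mem_ball_iff_norm] using hz
  have hnn : ∀ z, 0 ≤ χ (x + z) * f (x + z) * radialWeight z := fun z => by
    by_cases hz : z ∈ Metric.ball (0 : E) 1
    · exact mul_nonneg (mul_nonneg χ.nonneg (hf0 _ (hmem z hz))) (radialWeight_nonneg z)
    · rw [radialWeight_eq_zero hz, mul_zero]
  have hint : Integrable fun z => χ (x + z) * f (x + z) * radialWeight z :=
    Continuous.integrable_of_hasCompactSupport
      ((hsmooth.continuous.comp (continuous_const.add continuous_id)).mul continuous_radialWeight)
      hasCompactSupport_radialWeight.mul_left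
  have hle : ENNReal.ofReal (f x * K) ≤
      ENNReal.ofReal M * ∫⁻ z in Metric.ball x 1, ENNReal.ofReal (f z) :=
    calc ENNReal.ofReal (f x * K)
      _ ≤ ENNReal.ofReal (∫ z, χ (x + z) * f (x + z) * radialWeight z) :=
        ENNReal.ofReal_le_ofReal hsub
      _ = ∫⁻ z, ENNReal.ofReal (χ (x + z) * f (x + z) * radialWeight z) :=
        ofReal_integral_eq_lintegral_ofReal hint (Eventually.of_forall hnn)
      _ ≤ ∫⁻ z, (Metric.ball x 1).indicator
          (fun z => ENNReal.ofReal M * ENNReal.ofReal (f z)) (x + z) := by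
        refine lintegral_mono fun z => ?_
        by_cases hz : z ∈ Metric.ball (0 : E) 1
        · rw [Set.indicator_of_mem (hmem z hz), ← ENNReal.ofReal_mul hM0]
          refine ENNReal.ofReal_le_ofReal ?_
          rw [hχf _ (hmem z hz), mul_comm]
          exact mul_le_mul_of_nonneg_right ((le_abs_self _).trans (hM z)) (hf0 _ (hmem z hz))
        · simp [radialWeight_eq_zero hz]
      _ = ENNReal.ofReal M * ∫⁻ z in Metric.ball x 1, ENNReal.ofReal (f z) := by
        rw [lintegral_add_left_eq_self, lintegral_indicator measurableSet_ball,
          lintegral_const_mul' _ _ ENNReal.ofReal_ne_top]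
  have hfx : f x = f x * K * K⁻¹ := by field_simp
  rw [hfx, ENNReal.ofReal_mul' (inv_nonneg.2 hK.le), mul_comm]
  refine (mul_le_mul_right hle _).trans_eq ?_
  rw [← mul_assoc, ← ENNReal.ofReal_mul (inv_nonneg.2 hK.le), inv_mul_eq_div]
  rfl

end SubMeanValue

/-! ### Measurability and locality of the survival functional -/

section Survival

variable {d : ℕ} {Ω : Type*} [AddAction (EuclideanSpace ℝ (Fin d)) Ω]

theorem survival_le_one (V : Ω → ℝ) (ω : Ω) (t : ℝ) (w : PathSpace d) : survival V ω t w ≤ 1 := by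
  rw [survival, EReal.exp_le_one_iff, EReal.neg_le_zero]
  exact EReal.coe_ennreal_nonneg _

/-- Provides the locality hypothesis of the Cameron-Martin formula. -/
theorem survival_congr (V : Ω → ℝ) (ω : Ω) {t : ℝ≥0} {w w' : PathSpace d}
    (h : ∀ s ≤ t, w s = w' s) : survival V ω t w = survival V ω t w' := by
  have : ∫⁻ s in Set.Icc (0 : ℝ) t, ENNReal.ofReal (V (w s.toNNReal +ᵥ ω)) =
      ∫⁻ s in Set.Icc (0 : ℝ) t, ENNReal.ofReal (V (w' s.toNNReal +ᵥ ω)) :=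
    setLIntegral_congr_fun measurableSet_Icc fun s hs => by
      rw [h s.toNNReal (Real.toNNReal_le_iff_le_coe.2 hs.2)]
  rw [survival, survival, this]

theorem measurable_uncurry_eval :
    Measurable fun p : ℝ × PathSpace d => p.2 p.1.toNNReal := by
  refine measurable_uncurry_of_continuous_of_measurable
    (u := fun (s : ℝ) (w : PathSpace d) => w s.toNNReal) (fun w => ?_) fun s => measurable_eval d _
  exact w.continuous.comp continuous_real_toNNReal

variable [MeasurableSpace Ω] [MeasurableVAdd₂ (EuclideanSpace ℝ (Fin d)) Ω]

theorem measurable_uncurry_survival {V : Ω → ℝ} (hV : Measurable V) (ω : Ω) :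
    Measurable fun p : ℝ × PathSpace d => survival V ω p.1 p.2 := by
  have h1 : Measurable fun q : (ℝ × PathSpace d) × ℝ =>
      ENNReal.ofReal (V (q.1.2 q.2.toNNReal +ᵥ ω)) := by
    have : Measurable fun q : (ℝ × PathSpace d) × ℝ => q.1.2 q.2.toNNReal :=
      measurable_uncurry_eval.comp (measurable_snd.prodMk (measurable_snd.comp measurable_fst))
    exact (hV.comp (this.vadd_const ω)).ennreal_ofReal
  -- The domain $[0,t]$ varies with the parameter, so it is encoded as a jointly measurable
  -- indicator before integrating out `s`.
  have hS : MeasurableSet {q : (ℝ × PathSpace d) × ℝ | 0 ≤ q.2 ∧ q.2 ≤ q.1.1} :=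
    (measurableSet_le measurable_const measurable_snd).inter
      (measurableSet_le measurable_snd (measurable_fst.comp measurable_fst))
  have h2 := (h1.indicator hS).lintegral_prod_right' (ν := (volume : Measure ℝ))
  have h3 : (fun p : ℝ × PathSpace d => survival V ω p.1 p.2) = fun p : ℝ × PathSpace d =>
      EReal.exp (-((∫⁻ s, {q : (ℝ × PathSpace d) × ℝ | 0 ≤ q.2 ∧ q.2 ≤ q.1.1}.indicator
        (fun q => ENNReal.ofReal (V (q.1.2 q.2.toNNReal +ᵥ ω))) (p, s) : ℝ≥0∞) : EReal)) := by
    ext1 p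
    rw [survival, ← lintegral_indicator measurableSet_Icc]
    rfl
  rw [h3]
  exact EReal.measurable_exp.comp h2.coe_ereal_ennreal.neg

theorem measurable_survival {V : Ω → ℝ} (hV : Measurable V) (ω : Ω) (t : ℝ) :
    Measurable (survival V ω t : PathSpace d → ℝ≥0∞) :=
  (measurable_uncurry_survival hV ω).comp measurable_prodMk_left

end Survival

/-- The law of Brownian motion started at `0` without drift is the Wiener measure. -/
theorem driftLaw_zero_zero {d : ℕ} (P : Measure (PathSpace d)) : driftLaw P 0 0 = P := by
  have : driftPath (d := d) 0 0 = id := by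
    ext1 w
    ext1 t
    simp [driftPath]
  rw [driftLaw, this, Measure.map_id]

/-! ### Exponential bounds for the Green measure -/

/-- Exponential Chebyshev bound for the Green measure of a unit ball. -/
theorem greenMeasure_ball_le {d : ℕ} {P : Measure (PathSpace d)} (hP : IsWienerMeasure P)
    {Ω : Type*} [MeasurableSpace Ω] [AddAction (EuclideanSpace ℝ (Fin d)) Ω]
    [MeasurableVAdd₂ (EuclideanSpace ℝ (Fin d)) Ω] {V : Ω → ℝ} (hV : Measurable V) (ω : Ω)
    (lam x : EuclideanSpace ℝ (Fin d)) :
    greenMeasure P V 0 (Metric.ball x 1) ω ≤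
      ENNReal.ofReal (Real.exp (‖lam‖ - inner ℝ lam x)) *
        ∫⁻ t in Set.Ici (0 : ℝ), ENNReal.ofReal (Real.exp (‖lam‖ ^ 2 / 2 * t)) *
          ∫⁻ w, survival V ω t w ∂(driftLaw P 0 lam) := by
  have := hP.isProbabilityMeasure
  set a := ENNReal.ofReal (Real.exp (‖lam‖ - inner ℝ lam x))
  -- On the ball, $\langle\lambda,z-x\rangle\ge-|\lambda|$, so the right side is at least 1.
  have hind : ∀ z : EuclideanSpace ℝ (Fin d), (Metric.ball x 1).indicator (fun _ => (1 : ℝ≥0∞)) z ≤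
      a * ENNReal.ofReal (Real.exp (inner ℝ lam z)) := fun z => by
    by_cases hz : z ∈ Metric.ball x 1
    · rw [Set.indicator_of_mem hz, ← ENNReal.ofReal_mul (Real.exp_pos _).le, ← Real.exp_add,
        ENNReal.one_le_ofReal, Real.one_le_exp_iff]
      have h1 : |inner ℝ lam (z - x)| ≤ ‖lam‖ * ‖z - x‖ := abs_real_inner_le_norm _ _
      have h2 : ‖z - x‖ < 1 := mem_ball_iff_norm.1 hz
      rw [inner_sub_right] at h1
      nlinarith [neg_abs_le (inner ℝ lam z - inner ℝ lam x), norm_nonneg lam]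
    · simp [Set.indicator_of_notMem hz]
  have hm : Measurable fun p : PathSpace d × ℝ => survival V ω p.2 p.1 *
      (a * ENNReal.ofReal (Real.exp (inner ℝ lam (p.1 p.2.toNNReal)))) := by
    have h1 : Measurable fun p : PathSpace d × ℝ => p.1 p.2.toNNReal :=
      measurable_uncurry_eval.comp measurable_swap
    exact ((measurable_uncurry_survival hV ω).comp measurable_swap).mul
      ((Real.measurable_exp.comp (h1.const_inner (c := lam))).ennreal_ofReal.const_mul a)
  -- The tilt is $e^{|\lambda|^2t/2}$ times the Cameron-Martin density. That formula needs $t\ne0$,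
  -- hence the open half-line, which differs by a null set.
  have hpos : ∀ t ∈ Set.Ioi (0 : ℝ), ∫⁻ w, survival V ω t w *
      (a * ENNReal.ofReal (Real.exp (inner ℝ lam (w t.toNNReal)))) ∂P =
      a * (ENNReal.ofReal (Real.exp (‖lam‖ ^ 2 / 2 * t)) *
        ∫⁻ w, survival V ω t w ∂(driftLaw P 0 lam)) := fun t ht => by
    have ht0 : (t.toNNReal : ℝ) = t := Real.coe_toNNReal t (le_of_lt ht)
    rw [hP.lintegral_driftLaw lam (t := t.toNNReal) (Real.toNNReal_pos.2 ht).ne'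
      (measurable_survival hV ω t) fun w w' h => by
        have := survival_congr V ω h
        rwa [ht0] at this, ← lintegral_const_mul' _ _ ENNReal.ofReal_ne_top,
      ← lintegral_const_mul' _ _ ENNReal.ofReal_ne_top]
    refine lintegral_congr fun w => ?_
    have : Real.exp (inner ℝ lam (w t.toNNReal)) = Real.exp (‖lam‖ ^ 2 / 2 * t) *
        Real.exp (inner ℝ lam (w t.toNNReal) - ‖lam‖ ^ 2 * t.toNNReal / 2) := by
      rw [← Real.exp_add, ht0]
      ring_nf
    rw [this, ENNReal.ofReal_mul (Real.exp_pos _).le]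
    ring
  rw [greenMeasure, driftLaw_zero_zero]
  calc _ ≤ ∫⁻ w : PathSpace d, (∫⁻ t in Set.Ici (0 : ℝ), survival V ω t w *
        (a * ENNReal.ofReal (Real.exp (inner ℝ lam (w t.toNNReal))))) ∂P :=
      lintegral_mono fun w => lintegral_mono fun t => mul_le_mul_right (hind _) _
    _ = ∫⁻ t in Set.Ici (0 : ℝ), ∫⁻ w : PathSpace d, survival V ω t w *
        (a * ENNReal.ofReal (Real.exp (inner ℝ lam (w t.toNNReal)))) ∂P :=
      lintegral_lintegral_swap hm.aemeasurable
    _ = ∫⁻ t in Set.Ioi (0 : ℝ), ∫⁻ w : PathSpace d, survival V ω t w *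
        (a * ENNReal.ofReal (Real.exp (inner ℝ lam (w t.toNNReal)))) ∂P := by
      rw [setLIntegral_congr Ioi_ae_eq_Ici]
    _ = ∫⁻ t in Set.Ioi (0 : ℝ), a * (ENNReal.ofReal (Real.exp (‖lam‖ ^ 2 / 2 * t)) *
        ∫⁻ w, survival V ω t w ∂(driftLaw P 0 lam)) :=
      setLIntegral_congr_fun measurableSet_Ioi hpos
    _ = _ := by
      rw [lintegral_const_mul' _ _ ENNReal.ofReal_ne_top, setLIntegral_congr Ioi_ae_eq_Ici]

/-- If `|λ|² / 2` is below the exponential decay rate, the resolvent-type integral is finite. -/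
theorem lintegral_exp_mul_survival_lt_top {d : ℕ} {P : Measure (PathSpace d)}
    (hP : IsWienerMeasure P) {Ω : Type*} [AddAction (EuclideanSpace ℝ (Fin d)) Ω] (V : Ω → ℝ)
    (ω : Ω) (lam : EuclideanSpace ℝ (Fin d))
    (h : ((‖lam‖ ^ 2 / 2 : ℝ) : EReal) < -quenchedFreeEnergy P V ω lam) :
    ∫⁻ t in Set.Ici (0 : ℝ), ENNReal.ofReal (Real.exp (‖lam‖ ^ 2 / 2 * t)) *
      ∫⁻ w, survival V ω t w ∂(driftLaw P 0 lam) < ∞ := by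
  have := hP.isProbabilityMeasure
  have : IsProbabilityMeasure (driftLaw P 0 lam) :=
    Measure.isProbabilityMeasure_map (measurable_driftPath 0 lam).aemeasurable
  -- A real rate strictly between the two sides: past some `T` the expectation is at most $e^{-ct}$,
  -- so the integrand decays like $e^{-(c-|\lambda|^2/2)t}$. Before `T`, survival is at most 1.
  obtain ⟨c, hc1, hc2⟩ := EReal.lt_iff_exists_real_btwn.1 h
  rw [EReal.coe_lt_coe_iff] at hc1
  have hev : ∀ᶠ t : ℝ in atTop, ((1 / t : ℝ) : EReal) *
      ENNReal.log (∫⁻ w, survival V ω t w ∂(driftLaw P 0 lam)) < ((-c : ℝ) : EReal) :=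
    eventually_lt_of_limsup_lt (EReal.lt_neg_comm.1 hc2)
  obtain ⟨T, hT⟩ := eventually_atTop.1 (hev.and (eventually_gt_atTop 0))
  have hT0 : 0 < T := (hT T le_rfl).2
  have hlarge : ∀ t ∈ Set.Ioi T, ENNReal.ofReal (Real.exp (‖lam‖ ^ 2 / 2 * t)) *
      ∫⁻ w, survival V ω t w ∂(driftLaw P 0 lam) ≤
      ENNReal.ofReal (Real.exp (-(c - ‖lam‖ ^ 2 / 2) * t)) := fun t ht => by
    obtain ⟨h1, h2⟩ := hT t (le_of_lt ht)
    have h3 : ENNReal.log (∫⁻ w, survival V ω t w ∂(driftLaw P 0 lam)) ≤ ((-c * t : ℝ) : EReal) := by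
      have := mul_le_mul_of_nonneg_left h1.le (EReal.coe_nonneg.2 h2.le)
      rw [← mul_assoc, ← EReal.coe_mul, mul_one_div_cancel h2.ne', EReal.coe_one, one_mul,
        ← EReal.coe_mul, mul_comm] at this
      exact this
    have h4 : ∫⁻ w, survival V ω t w ∂(driftLaw P 0 lam) ≤ ENNReal.ofReal (Real.exp (-c * t)) := by
      rw [← EReal.exp_coe, ← ENNReal.log_le_log_iff, EReal.log_exp]
      exact h3
    refine (mul_le_mul_right h4 _).trans_eq ?_
    rw [← ENNReal.ofReal_mul (Real.exp_pos _).le, ← Real.exp_add]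
    ring_nf
  have hsmall : ∀ t ∈ Set.Icc 0 T, ENNReal.ofReal (Real.exp (‖lam‖ ^ 2 / 2 * t)) *
      ∫⁻ w, survival V ω t w ∂(driftLaw P 0 lam) ≤
      ENNReal.ofReal (Real.exp (‖lam‖ ^ 2 / 2 * T)) := fun t ht => by
    refine (mul_le_mul' (ENNReal.ofReal_le_ofReal (Real.exp_le_exp.2
      (mul_le_mul_of_nonneg_left ht.2 (by positivity))))
      ((lintegral_mono fun w => survival_le_one V ω t w).trans_eq (by simp))).trans_eq (mul_one _)
  rw [← Set.Icc_union_Ioi_eq_Ici hT0.le]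
  refine (lintegral_union_le _ _ _).trans_lt (ENNReal.add_lt_top.2 ⟨?_, ?_⟩)
  · refine (setLIntegral_mono' measurableSet_Icc hsmall).trans_lt ?_
    rw [setLIntegral_const]
    exact ENNReal.mul_lt_top ENNReal.ofReal_lt_top (by simp)
  · refine (setLIntegral_mono' measurableSet_Ioi hlarge).trans_lt ?_
    exact (exp_neg_integrableOn_Ioi T (sub_pos.2 hc1)).lintegral_lt_top

/-- An exponential upper bound on a function of `r` bounds its logarithmic decay rate below. -/
theorem le_liminf_neg_log_of_le_exp {f : ℝ → ℝ≥0∞} {K b : ℝ}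
    (h : ∀ᶠ r in atTop, f r ≤ ENNReal.ofReal (Real.exp (K - r * b))) :
    (b : EReal) ≤ liminf (fun r : ℝ => ((-(1 / r) : ℝ) : EReal) * ENNReal.log (f r)) atTop := by
  -- The hypothesis bounds the rate at `r` below by $b-K/r$.
  have hlim : Tendsto (fun r : ℝ => ((b - K / r : ℝ) : EReal)) atTop (nhds (b : EReal)) := by
    refine (continuous_coe_real_ereal.tendsto b).comp ?_
    simpa using (tendsto_const_nhds (x := b)).sub (tendsto_const_nhds.div_atTop tendsto_id)
  rw [← hlim.liminf_eq]
  refine liminf_le_liminf ?_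
  filter_upwards [h, eventually_gt_atTop 0] with r hr hr0
  have h1 : ENNReal.log (f r) ≤ ((K - r * b : ℝ) : EReal) := by
    rwa [← EReal.exp_le_exp_iff, ENNReal.exp_log, EReal.exp_coe]
  have h2 := mul_le_mul_of_nonneg_left h1 (EReal.coe_nonneg.2 (one_div_pos.2 hr0).le)
  rw [EReal.coe_neg, EReal.neg_mul, EReal.le_neg]
  refine h2.trans_eq ?_
  rw [← EReal.coe_mul, ← EReal.coe_neg]
  congr 1
  field_simp
  ring

end GreenDecay

/-! ### Pointwise decay of the Green function -/

theorem proposition3p6 {d : ℕ}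
    -- the Wiener measure on `C([0,∞), ℝ^d)`
    (P : Measure (GreenDecay.PathSpace d)) (hP : GreenDecay.IsWienerMeasure P)
    -- the probability space with its measure preserving action of `ℝ^d`
    {Ω : Type*} [MeasurableSpace Ω] (μ : Measure Ω) [IsProbabilityMeasure μ]
    [AddAction (EuclideanSpace ℝ (Fin d)) Ω] [MeasurableVAdd₂ (EuclideanSpace ℝ (Fin d)) Ω]
    [VAddInvariantMeasure (EuclideanSpace ℝ (Fin d)) Ω μ]
    -- the potential, with `g ω` the Green function `g(0, ·, ω)`
    (V : Ω → ℝ) (hV : GreenDecay.IsPotential d μ V)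
    (g : Ω → EuclideanSpace ℝ (Fin d) → ℝ) (hG : GreenDecay.ConditionG P V g)
    (ω : Ω) (y : EuclideanSpace ℝ (Fin d)) (hy : y ≠ 0) :
    GreenDecay.rateTransform (fun lam => -GreenDecay.quenchedFreeEnergy P V ω lam) y ≤
      liminf (fun r : ℝ =>
        ((-(1 / r) : ℝ) : EReal) * ENNReal.log (ENNReal.ofReal (g ω (r • y)))) atTop := by
  open GreenDecay in
  have : Nontrivial (EuclideanSpace ℝ (Fin d)) := ⟨⟨y, 0, hy⟩⟩
  obtain ⟨C, hC⟩ := exists_le_setLIntegral_of_laplacian_nonneg (E := EuclideanSpace ℝ (Fin d))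
  refine iSup₂_le fun lam hlam => ?_
  have hJ := lintegral_exp_mul_survival_lt_top hP V ω lam hlam
  have hball := greenMeasure_ball_le hP hV.measurable ω lam
  set J := ∫⁻ t in Set.Ici (0 : ℝ), ENNReal.ofReal (Real.exp (‖lam‖ ^ 2 / 2 * t)) *
    ∫⁻ w, survival V ω t w ∂(driftLaw P 0 lam)
  have hCJ : (C : ℝ≥0∞) * J ≠ ∞ := ENNReal.mul_ne_top ENNReal.coe_ne_top hJ.ne
  -- The prefactor $CJ$ is absorbed through $CJ\le e^{CJ}$, which also covers $CJ=0$.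
  refine le_liminf_neg_log_of_le_exp (K := (C * J).toReal + ‖lam‖) ?_
  -- For such `r` the closed ball of radius 2 around $ry$ misses the pole at `0`.
  filter_upwards [eventually_gt_atTop (2 / ‖y‖)] with r hr
  have hry : 2 < ‖r • y‖ := by
    have hr' := (div_lt_iff₀ (norm_pos_iff.2 hy)).1 hr
    rw [norm_smul]
    exact hr'.trans_le (mul_le_mul_of_nonneg_right (le_abs_self r) (norm_nonneg y))
  have hne : ∀ z ∈ Metric.closedBall (r • y) 2, z ≠ 0 := by
    rintro z hz rfl
    rw [mem_closedBall_iff_norm, zero_sub, norm_neg] at hz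
    exact hz.not_gt hry
  have hne' : ∀ z ∈ Metric.ball (r • y) 1, z ≠ 0 := fun z hz =>
    hne z (Metric.closedBall_subset_closedBall one_le_two (Metric.ball_subset_closedBall hz))
  have hg0 : ∀ z ∈ Metric.ball (r • y) 1, 0 ≤ g ω z := fun z hz =>
    (hG.isGreenFunction ω).nonneg z (hne' z hz)
  have hmean := hC (g ω) (r • y) {0}ᶜ isOpen_compl_singleton hne (hG.contDiffOn ω) hg0
    fun z hz => by
      have h1 := hG.equation ω z (hne' z hz)
      have h2 := mul_nonneg (hV.nonneg (z +ᵥ ω)) (hg0 z hz)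
      linarith
  rw [← (hG.isGreenFunction ω).density _ measurableSet_ball] at hmean
  calc ENNReal.ofReal (g ω (r • y))
    _ ≤ C * (ENNReal.ofReal (Real.exp (‖lam‖ - inner ℝ lam (r • y))) * J) :=
      hmean.trans (mul_le_mul_right (hball _) _)
    _ = ENNReal.ofReal (C * J).toReal *
        ENNReal.ofReal (Real.exp (‖lam‖ - inner ℝ lam (r • y))) := by
      rw [ENNReal.ofReal_toReal hCJ]; ring
    _ ≤ ENNReal.ofReal (Real.exp (C * J).toReal) *
        ENNReal.ofReal (Real.exp (‖lam‖ - inner ℝ lam (r • y))) :=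
      mul_le_mul_left (ENNReal.ofReal_le_ofReal
        ((lt_add_one _).le.trans (Real.add_one_le_exp _))) _
    _ = _ := by
      rw [← ENNReal.ofReal_mul (Real.exp_pos _).le, ← Real.exp_add, inner_smul_right,
        real_inner_comm lam y]
      ring_nf
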